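/- Let $R$ be a commutative ring. An $\mathcal R$-module is a covariant functor $\mathbb M$ from commutative $R$-algebras to abelian groups together with an $R'$-module structure on $\mathbb M(R')$ for every commutative $R$-algebra $R'$, functorial in $R'$; morphisms of $\mathcal R$-modules are the $R'$-linear morphisms of functors, and direct limits over directed sets are computed by $(\varinjlim_i \mathbb M_i)(R')=\varinjlim_i(\mathbb M_i(R'))$. Let $\mathcal R$ be the $\mathcal R$-module $R'\mapsto R'$. For an $R$-module $N$ let $\mathcal N$ be the $\mathcal R$-module $\mathcal N(R')=N\otimes_R R'$. For an $\mathcal R$-module $\mathbb M$ let $\mathbb M^*$ be the dual $\mathcal R$-module, $\mathbb M^*(R')=\operatorname{Hom}_{\mathcal R'}(\mathbb M_{|R'},\mathcal R_{|R'})$ (restrictions to commutative $R'$-algebras), let $\mathbb M_{qc}$ be the $\mathcal R$-module $R'\mapsto \mathbb M(R)\otimes_R R'$, and put $\mathbb M_{sch}:=((\mathbb M^*)_{qc})^*$. This is functorial in $\mathbb M$, and there is a natural morphism $\mathbb M\to\mathbb M_{sch}$, which maps $n\in\mathbb M(R')$ to the form $w\mapsto w_{R'}(n)$, for $w\in\mathbb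 M^*(R)$. **Theorem.** Let $R$ be a Noetherian commutative ring, $M$ an $R$-module and $\{M_i\}_{i\in I}$ the set of finitely generated submodules of $M$, ordered by inclusion. Let $\{\mathcal M_{i,sch}\}_{i\in I}$ be the direct system of $\mathcal R$-modules whose transition morphisms are induced by the inclusions $M_i\subseteq M_j$. 1. $M$ is a flat $R$-module if and only if $\mathcal M=\varinjlim_i \mathcal M_{i,sch}$ through the canonical morphism, that is, if and only if there is an isomorphism of $\mathcal R$-modules $\theta\colon \mathcal M\to\varinjlim_i\mathcal M_{i,sch}$ such that, for every $i$, the composite $\mathcal M_i\to\mathcal M\xrightarrow{\theta}\varinjlim_j\mathcal M_{j,sch}$ equals the composite $\mathcal M_i\to\mathcal M_{i,sch}\to\varinjlim_j\mathcal M_{j,sch}$ of the natural morphisms. 2. $M$ is a flat $R$-module if and only if there is some isomorphism of $\mathcal R$-modules $\mathcal M\simeq\varinjlim_i\mathcal M_{i,sch}$. 3. For every $i$, $\mathcal M_{i,sch}$ is isomorphic, as an $\mathcal R$-module, to $(\operatorname{Spec} S^\cdot(M_i^*))^\cdot$, the functor of points $R'\mapsto\operatorname{Hom}_{R\text{-sch}}(\operatorname{Spec}R',\operatorname{Spec}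 S^\cdot(M_i^*))$ of the spectrum of the symmetric algebra of $M_i^*=\operatorname{Hom}_R(M_i,R)$, with the $\mathcal R$-module structure for which restriction of the comorphism to $M_i^*$ is an isomorphism onto $R'\mapsto\operatorname{Hom}_R(M_i^*,R')$. -/

import Mathlib

open scoped TensorProduct

universe u v w w' w''

/-- An `𝓡`-module: a covariant functor `𝕄` from commutative `R`-algebras to abelian groups, with
an `A`-module structure on `𝕄(A)` for every commutative `R`-algebra `A`, such that
`𝕄(f)(a • m) = f(a) • 𝕄(f)(m)` for every morphism of `R`-algebras `f : A → B`. -/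
structure FunctorModule (R : Type u) [CommRing R] where
  obj : (A : Type u) → [CommRing A] → [Algebra R A] → Type w
  addCommGroup : (A : Type u) → [CommRing A] → [Algebra R A] → AddCommGroup (obj A)
  module : (A : Type u) → [CommRing A] → [Algebra R A] → Module A (obj A)
  map : {A B : Type u} → [CommRing A] → [Algebra R A] → [CommRing B] → [Algebra R B] →
    (A →ₐ[R] B) → obj A →+ obj B
  map_smul : ∀ {A B : Type u} [CommRing A] [Algebra R A] [CommRing B] [Algebra R B]
    (f : A →ₐ[R] B) (a : A) (m : obj A), map f (a • m) = f a • map f m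
  map_id : ∀ {A : Type u} [CommRing A] [Algebra R A] (m : obj A), map (AlgHom.id R A) m = m
  map_comp : ∀ {A B C : Type u} [CommRing A] [Algebra R A] [CommRing B] [Algebra R B]
    [CommRing C] [Algebra R C] (g : B →ₐ[R] C) (f : A →ₐ[R] B) (m : obj A),
    map (g.comp f) m = map g (map f m)

namespace FunctorModule

attribute [instance] FunctorModule.addCommGroup FunctorModule.module

section

variable {R : Type u} [CommRing R]

/-- A morphism of `𝓡`-modules. -/
@[ext]
structure Hom (𝕄 : FunctorModule.{u, w} R) (𝕃 : FunctorModule.{u, w'} R) where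
  app : (A : Type u) → [CommRing A] → [Algebra R A] → 𝕄.obj A →ₗ[A] 𝕃.obj A
  naturality : ∀ {A B : Type u} [CommRing A] [Algebra R A] [CommRing B] [Algebra R B]
    (f : A →ₐ[R] B) (m : 𝕄.obj A), app B (𝕄.map f m) = 𝕃.map f (app A m)

namespace Hom

/-- The identity morphism. -/
def id (𝕄 : FunctorModule.{u, w} R) : Hom 𝕄 𝕄 where
  app _ _ _ := LinearMap.id
  naturality _ _ := rfl

/-- The composite `g ∘ f`. -/
def comp {𝕄 : FunctorModule.{u, w} R} {𝕃 : FunctorModule.{u, w'} R}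
    {ℙ : FunctorModule.{u, w''} R} (g : Hom 𝕃 ℙ) (f : Hom 𝕄 𝕃) : Hom 𝕄 ℙ where
  app A _ _ := (g.app A).comp (f.app A)
  naturality h m := by simp [f.naturality, g.naturality]

/-- `f` is an isomorphism of `𝓡`-modules: it has a two-sided inverse morphism. -/
def IsIso {𝕄 : FunctorModule.{u, w} R} {𝕃 : FunctorModule.{u, w'} R} (f : Hom 𝕄 𝕃) : Prop :=
  ∃ g : Hom 𝕃 𝕄, g.comp f = Hom.id 𝕄 ∧ f.comp g = Hom.id 𝕃

end Hom

/-! ### Quasi-coherent modules -/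

/-- The quasi-coherent `𝓡`-module `𝓝` associated with the `R`-module `N`: `𝓝(A) = A ⊗_R N`. -/
noncomputable abbrev qc (R : Type u) [CommRing R] (N : Type v) [AddCommGroup N] [Module R N] :
    FunctorModule.{u, max u v} R where
  obj A _ _ := A ⊗[R] N
  addCommGroup A _ _ := inferInstance
  module A _ _ := inferInstance
  map f := (f.toLinearMap.rTensor N).toAddMonoidHom
  map_smul f a m := by
    induction m using TensorProduct.induction_on with
    | zero => simp
    | tmul x y => simp [TensorProduct.smul_tmul']
    | add x y hx hy =>
      simp only [smul_add, _root_.map_add, hx, hy]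
  map_id m := by
    induction m using TensorProduct.induction_on with
    | zero => simp
    | tmul x y => simp
    | add x y hx hy => simp only [_root_.map_add, hx, hy]
  map_comp g f m := by
    induction m using TensorProduct.induction_on with
    | zero => simp
    | tmul x y => simp
    | add x y hx hy => simp only [_root_.map_add, hx, hy]

/-- The morphism of quasi-coherent modules induced by an `R`-linear map. -/
noncomputable def qcMap {N : Type v} [AddCommGroup N] [Module R N] {N' : Type w}
    [AddCommGroup N'] [Module R N'] (l : N →ₗ[R] N') : Hom (qc R N) (qc R N') where
  app A _ _ := (l.baseChange A : A ⊗[R] N →ₗ[A] A ⊗[R] N')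
  naturality {A B} _ _ _ _ f m := by
    change (l.baseChange B) (f.toLinearMap.rTensor N m) =
      f.toLinearMap.rTensor N' (l.baseChange A m)
    induction m using TensorProduct.induction_on with
    | zero => simp
    | tmul x y => simp
    | add x y hx hy => simp only [_root_.map_add, hx, hy]

theorem qcMap_id (N : Type v) [AddCommGroup N] [Module R N] :
    qcMap (LinearMap.id : N →ₗ[R] N) = Hom.id (qc R N) :=
  Hom.ext (by funext A _ _; exact LinearMap.baseChange_id)

theorem qcMap_comp {N : Type v} [AddCommGroup N] [Module R N] {N' : Type w}
    [AddCommGroup N'] [Module R N'] {N'' : Type w'} [AddCommGroup N''] [Module R N'']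
    (l' : N' →ₗ[R] N'') (l : N →ₗ[R] N') :
    qcMap (l' ∘ₗ l) = (qcMap l').comp (qcMap l) :=
  Hom.ext (by funext A _ _; exact LinearMap.baseChange_comp _ _)

/-! ### The dual `𝕄^* = ℍom_𝓡(𝕄, 𝓡)` -/

/-- An element of `𝕄^*(A) = Hom_𝓐(𝕄|_A, 𝓡|_A)`. A commutative `A`-algebra is given as a
commutative `R`-algebra `B` with a morphism of `R`-algebras `f : A → B`. -/
@[ext]
structure DualObj (𝕄 : FunctorModule.{u, w} R) (A : Type u) [CommRing A] [Algebra R A] where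
  app : (B : Type u) → [CommRing B] → [Algebra R B] → (A →ₐ[R] B) → 𝕄.obj B →ₗ[B] B
  naturality : ∀ {B C : Type u} [CommRing B] [Algebra R B] [CommRing C] [Algebra R C]
    (f : A →ₐ[R] B) (g : B →ₐ[R] C) (m : 𝕄.obj B),
    app C (g.comp f) (𝕄.map g m) = g (app B f m)

namespace DualObj

variable {𝕄 : FunctorModule.{u, w} R} {A : Type u} [CommRing A] [Algebra R A]

instance : Zero (DualObj 𝕄 A) := ⟨⟨fun _ _ _ _ => 0, by simp⟩⟩

instance : Add (DualObj 𝕄 A) :=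
  ⟨fun s t => ⟨fun B _ _ f => s.app B f + t.app B f, by simp [s.naturality, t.naturality]⟩⟩

instance : Neg (DualObj 𝕄 A) :=
  ⟨fun s => ⟨fun B _ _ f => -s.app B f, by simp [s.naturality]⟩⟩

/-- `(a • s)_{B,f} = f(a) • s_{B,f}`. -/
instance : SMul A (DualObj 𝕄 A) :=
  ⟨fun a s => ⟨fun B _ _ f => f a • s.app B f, by simp [s.naturality]⟩⟩

theorem ext' {s t : DualObj 𝕄 A}
    (h : ∀ (B : Type u) [CommRing B] [Algebra R B] (f : A →ₐ[R] B) (m : 𝕄.obj B),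
      s.app B f m = t.app B f m) : s = t := by
  apply DualObj.ext
  funext B _ _ f
  exact LinearMap.ext (h B f)

section
variable (s t : DualObj 𝕄 A) (a : A) (B : Type u) [CommRing B] [Algebra R B] (f : A →ₐ[R] B)
  (m : 𝕄.obj B)
@[simp] theorem zero_app : (0 : DualObj 𝕄 A).app B f m = 0 := rfl
@[simp] theorem add_app : (s + t).app B f m = s.app B f m + t.app B f m := rfl
@[simp] theorem neg_app : (-s).app B f m = -s.app B f m := rfl
@[simp] theorem smul_app : (a • s).app B f m = f a * s.app B f m := rfl
end

instance : AddCommGroup (DualObj 𝕄 A) where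
  add_assoc _ _ _ := ext' fun _ _ _ _ _ => by simp [add_assoc]
  zero_add _ := ext' fun _ _ _ _ _ => by simp
  add_zero _ := ext' fun _ _ _ _ _ => by simp
  nsmul := nsmulRec
  zsmul := zsmulRec
  neg_add_cancel _ := ext' fun _ _ _ _ _ => by simp
  add_comm _ _ := ext' fun _ _ _ _ _ => by simp [add_comm]

instance : Module A (DualObj 𝕄 A) where
  one_smul _ := ext' fun _ _ _ _ _ => by simp
  mul_smul _ _ _ := ext' fun _ _ _ _ _ => by simp [mul_assoc]
  smul_zero _ := ext' fun _ _ _ _ _ => by simp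
  smul_add _ _ _ := ext' fun _ _ _ _ _ => by simp [mul_add]
  add_smul _ _ _ := ext' fun _ _ _ _ _ => by simp [add_mul]
  zero_smul _ := ext' fun _ _ _ _ _ => by simp

end DualObj

/-- The dual `𝕄^*` of an `𝓡`-module. -/
abbrev dual (𝕄 : FunctorModule.{u, w} R) : FunctorModule.{u, max (u + 1) w} R where
  obj A _ _ := DualObj 𝕄 A
  addCommGroup A _ _ := inferInstance
  module A _ _ := inferInstance
  map h :=
    { toFun s := ⟨fun B _ _ f => s.app B (f.comp h), fun f g m => by
        rw [AlgHom.comp_assoc]; exact s.naturality _ g m⟩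
      map_zero' := rfl
      map_add' _ _ := rfl }
  map_smul _ _ _ := rfl
  map_id _ := rfl
  map_comp _ _ _ := rfl

/-- The dual morphism `ℕ^* → 𝕄^*` of a morphism `𝕄 → ℕ`. -/
def dualMap {𝕄 : FunctorModule.{u, w} R} {𝕃 : FunctorModule.{u, w'} R} (φ : Hom 𝕄 𝕃) :
    Hom (dual 𝕃) (dual 𝕄) where
  app A _ _ :=
    { toFun s := ⟨fun B _ _ f => (s.app B f).comp (φ.app B), fun f g m => by
        simp [φ.naturality, s.naturality]⟩
      map_add' _ _ := rfl
      map_smul' _ _ := rfl }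
  naturality _ _ := rfl

/-! ### The `𝓡`-module `𝕄_sch` -/

/-- `𝕄_sch := ((𝕄^*)_qc)^*`, where `ℕ_qc` is the quasi-coherent module associated with `ℕ(R)`. -/
noncomputable abbrev sch (𝕄 : FunctorModule.{u, w} R) : FunctorModule.{u, max (u + 1) w} R :=
  dual (qc R ((dual 𝕄).obj R))

/-- The morphism `𝕄_sch → ℕ_sch` induced by a morphism `𝕄 → ℕ`. -/
noncomputable def schMap {𝕄 : FunctorModule.{u, w} R} {𝕃 : FunctorModule.{u, w'} R}
    (φ : Hom 𝕄 𝕃) : Hom (sch 𝕄) (sch 𝕃) :=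
  dualMap (qcMap ((dualMap φ).app R))

theorem schMap_id (𝕄 : FunctorModule.{u, w} R) : schMap (Hom.id 𝕄) = Hom.id (sch 𝕄) := by
  have h : (dualMap (Hom.id 𝕄)).app R = LinearMap.id := rfl
  rw [schMap, h, qcMap_id]
  rfl

theorem schMap_comp {𝕄 : FunctorModule.{u, w} R} {𝕃 : FunctorModule.{u, w'} R}
    {ℙ : FunctorModule.{u, w''} R} (g : Hom 𝕃 ℙ) (f : Hom 𝕄 𝕃) :
    schMap (g.comp f) = (schMap g).comp (schMap f) := by
  have h : (dualMap (g.comp f)).app R = (dualMap f).app R ∘ₗ (dualMap g).app R := rfl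
  rw [schMap, h, qcMap_comp]
  rfl

/-- For `n ∈ 𝕄(A)`, the `A`-linear map `A ⊗_R 𝕄^*(R) → A`, `a ⊗ w ↦ a · w_A(n)`. -/
noncomputable def evalAt (𝕄 : FunctorModule.{u, w} R) {A : Type u} [CommRing A] [Algebra R A]
    (n : 𝕄.obj A) : A ⊗[R] DualObj 𝕄 R →ₗ[A] A :=
  TensorProduct.AlgebraTensorModule.lift
    (LinearMap.toSpanSingleton A (DualObj 𝕄 R →ₗ[R] A)
      { toFun := fun w => w.app A (Algebra.ofId R A) n
        map_add' := fun _ _ => rfl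
        map_smul' := fun r w => by
          simp [Algebra.smul_def, Algebra.ofId_apply] })

section
variable (𝕄 : FunctorModule.{u, w} R) {A : Type u} [CommRing A] [Algebra R A]

theorem evalAt_tmul (n : 𝕄.obj A) (a : A) (w : DualObj 𝕄 R) :
    evalAt 𝕄 n (a ⊗ₜ w) = a * w.app A (Algebra.ofId R A) n :=
  rfl

theorem evalAt_map (n : 𝕄.obj A) {B : Type u} [CommRing B] [Algebra R B] (g : A →ₐ[R] B)
    (m : A ⊗[R] DualObj 𝕄 R) :
    evalAt 𝕄 (𝕄.map g n) (g.toLinearMap.rTensor (DualObj 𝕄 R) m) = g (evalAt 𝕄 n m) := by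
  induction m using TensorProduct.induction_on with
  | zero => simp
  | tmul x y =>
    have h := y.naturality (Algebra.ofId R A) g n
    rw [Subsingleton.elim (g.comp (Algebra.ofId R A)) (Algebra.ofId R B)] at h
    simp [evalAt_tmul, h]
  | add x y hx hy => simp only [_root_.map_add, hx, hy]

theorem evalAt_add (n n' : 𝕄.obj A) (m : A ⊗[R] DualObj 𝕄 R) :
    evalAt 𝕄 (n + n') m = evalAt 𝕄 n m + evalAt 𝕄 n' m := by
  induction m using TensorProduct.induction_on with
  | zero => simp
  | tmul x y => simp [evalAt_tmul, mul_add]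
  | add x y hx hy => simp only [_root_.map_add, hx, hy]; abel

theorem evalAt_smul (a : A) (n : 𝕄.obj A) (m : A ⊗[R] DualObj 𝕄 R) :
    evalAt 𝕄 (a • n) m = a * evalAt 𝕄 n m := by
  induction m using TensorProduct.induction_on with
  | zero => simp
  | tmul x y => simp [evalAt_tmul, mul_left_comm]
  | add x y hx hy => simp only [_root_.map_add, hx, hy, mul_add]

end

/-- The natural morphism `𝕄 → 𝕄_sch`, which maps `n ∈ 𝕄(A)` to the form `w ↦ w_A(n)`. -/
noncomputable def toSch (𝕄 : FunctorModule.{u, w} R) : Hom 𝕄 (sch 𝕄) where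
  app A _ _ :=
    { toFun := fun n =>
        { app := fun B _ _ f => evalAt 𝕄 (𝕄.map f n)
          naturality := fun {B C} _ _ _ _ f g m => by
            rw [𝕄.map_comp]
            exact evalAt_map 𝕄 (𝕄.map f n) g m }
      map_add' := fun x y => DualObj.ext' fun B _ _ f m => by
        change evalAt 𝕄 (𝕄.map f (x + y)) m = _
        rw [_root_.map_add]
        exact evalAt_add 𝕄 _ _ m
      map_smul' := fun a x => DualObj.ext' fun B _ _ f m => by
        change evalAt 𝕄 (𝕄.map f (a • x)) m = _
        rw [𝕄.map_smul]
        exact evalAt_smul 𝕄 _ _ m }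
  naturality f m := DualObj.ext' fun B _ _ g n => by
    change evalAt 𝕄 (𝕄.map g (𝕄.map f m)) n = evalAt 𝕄 (𝕄.map (g.comp f) m) n
    rw [𝕄.map_comp]

/-! ### Direct limits -/

/-- A direct system of `𝓡`-modules indexed by `I`. -/
structure DirectSystem (R : Type u) [CommRing R] (I : Type v) [Preorder I] where
  obj : I → FunctorModule.{u, w} R
  hom : ∀ {i j : I}, i ≤ j → Hom (obj i) (obj j)
  hom_refl : ∀ i, hom (le_refl i) = Hom.id (obj i)
  hom_trans : ∀ {i j k} (hij : i ≤ j) (hjk : j ≤ k),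
    (hom hjk).comp (hom hij) = hom (hij.trans hjk)

namespace DirectSystem

variable {I : Type v} [Preorder I]

open scoped Classical in
/-- The `A`-module `lim_i 𝔽_i(A)`. -/
def limObj (𝔽 : DirectSystem.{u, v, w} R I) (A : Type u) [CommRing A] [Algebra R A] :
    Type (max v w) :=
  Module.DirectLimit (R := A) (fun i => (𝔽.obj i).obj A) (fun _ _ h => (𝔽.hom h).app A)

open scoped Classical in
noncomputable instance (𝔽 : DirectSystem.{u, v, w} R I) (A : Type u) [CommRing A] [Algebra R A] :
    AddCommGroup (𝔽.limObj A) :=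
  inferInstanceAs (AddCommGroup (Module.DirectLimit (R := A) (fun i => (𝔽.obj i).obj A)
    (fun _ _ h => (𝔽.hom h).app A)))

open scoped Classical in
noncomputable instance (𝔽 : DirectSystem.{u, v, w} R I) (A : Type u) [CommRing A] [Algebra R A] :
    Module A (𝔽.limObj A) :=
  inferInstanceAs (Module A (Module.DirectLimit (R := A) (fun i => (𝔽.obj i).obj A)
    (fun _ _ h => (𝔽.hom h).app A)))

open scoped Classical in
/-- The canonical map `𝔽_i(A) → lim_i 𝔽_i(A)`. -/
noncomputable def limOf (𝔽 : DirectSystem.{u, v, w} R I) (i : I) (A : Type u) [CommRing A]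
    [Algebra R A] : (𝔽.obj i).obj A →ₗ[A] 𝔽.limObj A :=
  Module.DirectLimit.of A I (fun i => (𝔽.obj i).obj A) (fun _ _ h => (𝔽.hom h).app A) i

theorem limOf_compat (𝔽 : DirectSystem.{u, v, w} R I) {A B : Type u} [CommRing A]
    [Algebra R A] [CommRing B] [Algebra R B] (f : A →ₐ[R] B) (i j : I) (h : i ≤ j)
    (x : (𝔽.obj i).obj A) :
    𝔽.limOf j B ((𝔽.obj j).map f ((𝔽.hom h).app A x)) = 𝔽.limOf i B ((𝔽.obj i).map f x) := by
  classical
  rw [← (𝔽.hom h).naturality]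
  exact Module.DirectLimit.of_f (R := B) (G := fun i => (𝔽.obj i).obj B)
    (f := fun _ _ h => (𝔽.hom h).app B)

open scoped Classical in
/-- The map `lim_i 𝔽_i(A) → lim_i 𝔽_i(B)` induced by `f : A → B`; the `B`-modules are viewed as
`A`-modules through `f`. -/
noncomputable def limMap (𝔽 : DirectSystem.{u, v, w} R I) {A B : Type u} [CommRing A]
    [Algebra R A] [CommRing B] [Algebra R B] (f : A →ₐ[R] B) : 𝔽.limObj A →+ 𝔽.limObj B :=
  letI : Module A (𝔽.limObj B) := Module.compHom _ f.toRingHom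
  (Module.DirectLimit.lift A I (fun i => (𝔽.obj i).obj A) (fun _ _ h => (𝔽.hom h).app A)
    (fun i =>
      { toFun := fun m => 𝔽.limOf i B ((𝔽.obj i).map f m)
        map_add' := fun x y => by simp
        map_smul' := fun a x => by
          rw [(𝔽.obj i).map_smul, LinearMap.map_smul]; rfl })
    (𝔽.limOf_compat f)).toAddMonoidHom

@[simp] theorem limMap_limOf (𝔽 : DirectSystem.{u, v, w} R I) {A B : Type u} [CommRing A]
    [Algebra R A] [CommRing B] [Algebra R B] (f : A →ₐ[R] B) (i : I) (m : (𝔽.obj i).obj A) :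
    𝔽.limMap f (𝔽.limOf i A m) = 𝔽.limOf i B ((𝔽.obj i).map f m) := by
  classical
  let _ : Module A (𝔽.limObj B) := Module.compHom _ f.toRingHom
  exact Module.DirectLimit.lift_of (R := A) (G := fun i => (𝔽.obj i).obj A)
    (f := fun _ _ h => (𝔽.hom h).app A) (P := 𝔽.limObj B) _ (𝔽.limOf_compat f) m

theorem exists_limOf [IsDirectedOrder I] [Nonempty I] (𝔽 : DirectSystem.{u, v, w} R I) {A : Type u}
    [CommRing A] [Algebra R A] (x : 𝔽.limObj A) : ∃ i m, 𝔽.limOf i A m = x := by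
  classical
  exact Module.DirectLimit.exists_of (R := A) (G := fun i => (𝔽.obj i).obj A)
    (f := fun _ _ h => (𝔽.hom h).app A) x

/-- The direct limit `lim_i 𝔽_i` over an upward directed set: `(lim_i 𝔽_i)(A) = lim_i 𝔽_i(A)`. -/
noncomputable abbrev lim [IsDirectedOrder I] [Nonempty I] (𝔽 : DirectSystem.{u, v, w} R I) :
    FunctorModule.{u, max v w} R where
  obj A _ _ := 𝔽.limObj A
  addCommGroup A _ _ := inferInstance
  module A _ _ := inferInstance
  map f := 𝔽.limMap f
  map_smul f a x := by
    obtain ⟨i, m, rfl⟩ := 𝔽.exists_limOf x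
    rw [← LinearMap.map_smul, limMap_limOf, limMap_limOf, (𝔽.obj i).map_smul, LinearMap.map_smul]
  map_id x := by
    obtain ⟨i, m, rfl⟩ := 𝔽.exists_limOf x
    rw [limMap_limOf, (𝔽.obj i).map_id]
  map_comp g f x := by
    obtain ⟨i, m, rfl⟩ := 𝔽.exists_limOf x
    rw [limMap_limOf, limMap_limOf, limMap_limOf, (𝔽.obj i).map_comp]

/-- The canonical morphism `𝔽_i → lim_i 𝔽_i`. -/
noncomputable def toLim [IsDirectedOrder I] [Nonempty I] (𝔽 : DirectSystem.{u, v, w} R I) (i : I) :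
    Hom (𝔽.obj i) 𝔽.lim where
  app A _ _ := 𝔽.limOf i A
  naturality f m := (𝔽.limMap_limOf f i m).symm

end DirectSystem

/-! ### The direct system of the `𝓜_{i,sch}` -/

section
variable (R) (M : Type v) [AddCommGroup M] [Module R M]

/-- The finitely generated submodules of `M`, ordered by inclusion. -/
abbrev FGSubmodule := {N : Submodule R M // N.FG}

instance : Nonempty (FGSubmodule R M) := ⟨⟨⊥, Submodule.fg_bot⟩⟩

instance : IsDirectedOrder (FGSubmodule R M) :=
  ⟨fun N N' => ⟨⟨N.1 ⊔ N'.1, N.2.sup N'.2⟩, (le_sup_left : N.1 ≤ N.1 ⊔ N'.1),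
    (le_sup_right : N'.1 ≤ N.1 ⊔ N'.1)⟩⟩

/-- The direct system `{𝓜_{i,sch}}`, `M_i` running over the finitely generated submodules of `M`,
with the morphisms `𝓜_{i,sch} → 𝓜_{j,sch}` induced by the inclusions `M_i ⊆ M_j`. -/
noncomputable abbrev schSystem : DirectSystem.{u, v, max (u + 1) v} R (FGSubmodule R M) where
  obj N := sch (qc R N.1)
  hom h := schMap (qcMap (Submodule.inclusion h))
  hom_refl N := by
    rw [show Submodule.inclusion (le_refl N.1) = LinearMap.id from rfl, qcMap_id, schMap_id]
  hom_trans {N N' N''} h h' := by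
    rw [← schMap_comp, ← qcMap_comp]
    rfl

end

/-! ### The module scheme `Spec S^·(N)` -/

section
open AlgebraicGeometry CategoryTheory

variable (R) in
/-- The `A`-points of the `R`-scheme `Spec S^·(N)`: the morphisms `Spec A → Spec S^·(N)` of schemes
over `Spec R`. -/
def SpecSymPoint (N : Type u) [AddCommGroup N] [Module R N] (A : Type u) [CommRing A]
    [Algebra R A] : Type u :=
  {g : Spec (.of A) ⟶ Spec (.of (SymmetricAlgebra R N)) //
    g ≫ Spec.map (CommRingCat.ofHom (algebraMap R (SymmetricAlgebra R N))) =
      Spec.map (CommRingCat.ofHom (algebraMap R A))}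

namespace SpecSymPoint

variable {N : Type u} [AddCommGroup N] [Module R N]
variable {A : Type u} [CommRing A] [Algebra R A] {B : Type u} [CommRing B] [Algebra R B]

/-- The comorphism `S^·(N) → A` of an `A`-point of `Spec S^·(N)`. -/
noncomputable def toAlgHom (g : SpecSymPoint R N A) : SymmetricAlgebra R N →ₐ[R] A :=
  { (Spec.preimage g.1).hom with
    commutes' := fun r => by
      have h : CommRingCat.ofHom (algebraMap R (SymmetricAlgebra R N)) ≫ Spec.preimage g.1 =
          CommRingCat.ofHom (algebraMap R A) := by
        apply Spec.map_injective
        rw [Spec.map_comp, Spec.map_preimage]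
        exact g.2
      exact congrArg (fun k => k.hom r) h }

/-- The `A`-points of `Spec S^·(N)` are the morphisms of `R`-algebras `S^·(N) → A`. -/
noncomputable def algHomEquiv : SpecSymPoint R N A ≃ (SymmetricAlgebra R N →ₐ[R] A) where
  toFun := toAlgHom
  invFun l := ⟨Spec.map (CommRingCat.ofHom l.toRingHom), by
    rw [← Spec.map_comp, ← CommRingCat.ofHom_comp]
    exact congrArg (fun k => Spec.map (CommRingCat.ofHom k)) l.comp_algebraMap⟩
  left_inv g := Subtype.ext (Spec.map_preimage g.1)
  right_inv l := by
    ext x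
    simp [toAlgHom]

/-- The `A`-points of `Spec S^·(N)` are the `R`-linear maps `N → A`. -/
noncomputable def equiv : SpecSymPoint R N A ≃ (N →ₗ[R] A) :=
  algHomEquiv.trans SymmetricAlgebra.lift.symm

theorem equiv_apply (g : SpecSymPoint R N A) (n : N) :
    equiv g n = toAlgHom g (SymmetricAlgebra.ι R N n) := rfl

/-- The structure of `A`-module on the `A`-points of `Spec S^·(N)`: addition and scalar
multiplication are those whose comorphisms send `n ∈ N` to `n ⊗ 1 + 1 ⊗ n` and to `a ⊗ n`. -/
noncomputable instance : AddCommGroup (SpecSymPoint R N A) := equiv.addCommGroup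

noncomputable instance : Module A (SpecSymPoint R N A) := equiv.module A

/-- The composite of an `A`-point with `Spec B → Spec A`. -/
noncomputable def map (f : A →ₐ[R] B) (g : SpecSymPoint R N A) : SpecSymPoint R N B :=
  ⟨Spec.map (CommRingCat.ofHom f.toRingHom) ≫ g.1, by
    rw [Category.assoc, g.2, ← Spec.map_comp, ← CommRingCat.ofHom_comp]
    congr 2
    exact f.comp_algebraMap⟩

theorem equiv_map (f : A →ₐ[R] B) (g : SpecSymPoint R N A) :
    equiv (map f g) = f.toLinearMap ∘ₗ equiv g := by
  have h : Spec.preimage (map f g).1 = Spec.preimage g.1 ≫ CommRingCat.ofHom f.toRingHom := by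
    apply Spec.map_injective
    rw [Spec.map_comp, Spec.map_preimage, Spec.map_preimage]
    rfl
  ext n
  exact congrArg (fun k => k.hom (SymmetricAlgebra.ι R N n)) h

theorem equiv_zero : equiv (0 : SpecSymPoint R N A) = 0 :=
  equiv.apply_symm_apply _

theorem equiv_add (g h : SpecSymPoint R N A) : equiv (g + h) = equiv g + equiv h :=
  equiv.apply_symm_apply _

theorem equiv_smul (a : A) (g : SpecSymPoint R N A) : equiv (a • g) = a • equiv g :=
  equiv.apply_symm_apply _

end SpecSymPoint

open SpecSymPoint in
variable (R) in
/-- The `𝓡`-module `(Spec S^·(N))^·`, the functor of points of the `R`-module scheme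
`Spec S^·(N)`. -/
noncomputable abbrev specSym (N : Type u) [AddCommGroup N] [Module R N] :
    FunctorModule.{u, u} R where
  obj A _ _ := SpecSymPoint R N A
  addCommGroup A _ _ := inferInstance
  module A _ _ := inferInstance
  map f :=
    { toFun := SpecSymPoint.map f
      map_zero' := equiv.injective (by rw [equiv_map, equiv_zero, equiv_zero, LinearMap.comp_zero])
      map_add' := fun g h => equiv.injective (by
        simp only [equiv_map, equiv_add, LinearMap.comp_add]) }
  map_smul f a g := equiv.injective (by
    ext n
    change equiv (SpecSymPoint.map f (a • g)) n = equiv (f a • SpecSymPoint.map f g) n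
    simp [equiv_map, equiv_smul])
  map_id g := equiv.injective (equiv_map _ g)
  map_comp h f g := equiv.injective (by
    change equiv (SpecSymPoint.map (h.comp f) g) =
      equiv (SpecSymPoint.map h (SpecSymPoint.map f g))
    simp only [equiv_map]
    rfl)

end

end
end FunctorModule

/-! For an `R`-module `N`, a form on `𝓝|_A` is the same as an `R`-linear map `N → A`
(`dualQcEquiv`). Hence `𝓝_sch(A) = Hom_R(N^*, A)`, which for part 3 is the set of `A`-points of
`Spec S^·(N^*)`.

Isomorphism implies flat: `Hom_R(P, -)` preserves injections, and so do directed limits, so `A ↦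
lim_i 𝓜_{i,sch}(A)` preserves injections of `R`-algebras. Any isomorphism with `𝓜`, canonical or
not, transfers this to `A ↦ A ⊗ M`. Square-zero extensions turn the inclusion of an ideal `I` into
an injection of algebras, and flatness follows (`flat_of_qc_map_injective`).

Flat implies isomorphism: over a Noetherian ring each `M_i` is finitely presented, so when `M` is
flat the inclusion `M_i → M` factors through some `R^k`. For `F = R^k` the morphism `𝓕 → 𝓕_sch` is
bijective (`toSch_qc_bijective`), and naturality (`schMap_app_toSch`) carries injectivity and
surjectivity over to the limit. -/

namespace FunctorModule

section

variable {R : Type u} [CommRing R]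

/-- A morphism of `𝓡`-modules which is bijective on every algebra is an isomorphism. -/
theorem Hom.isIso_of_bijective {𝕄 : FunctorModule.{u, w} R} {𝕃 : FunctorModule.{u, w'} R}
    (f : Hom 𝕄 𝕃)
    (hf : ∀ (A : Type u) [CommRing A] [Algebra R A], Function.Bijective (f.app A)) : f.IsIso := by
  refine ⟨⟨fun A _ _ => (LinearEquiv.ofBijective (f.app A) (hf A)).symm, ?_⟩, ?_, ?_⟩
  · intro A B _ _ _ _ h m
    apply (hf B).1
    rw [f.naturality]
    have h₁ := (LinearEquiv.ofBijective (f.app A) (hf A)).apply_symm_apply m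
    have h₂ := (LinearEquiv.ofBijective (f.app B) (hf B)).apply_symm_apply (𝕃.map h m)
    exact h₂.trans (congrArg _ h₁.symm)
  · ext A _ _ m
    exact (LinearEquiv.ofBijective (f.app A) (hf A)).symm_apply_apply m
  · ext A _ _ m
    exact (LinearEquiv.ofBijective (f.app A) (hf A)).apply_symm_apply m

theorem Hom.IsIso.injective {𝕄 : FunctorModule.{u, w} R} {𝕃 : FunctorModule.{u, w'} R}
    {f : Hom 𝕄 𝕃} (hf : f.IsIso) (A : Type u) [CommRing A] [Algebra R A] :
    Function.Injective (f.app A) := by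
  obtain ⟨g, hg, -⟩ := hf
  refine Function.LeftInverse.injective (g := g.app A) fun m => ?_
  exact congrArg (fun k : Hom 𝕄 𝕄 => k.app A m) hg

/-! ### The dual of a quasi-coherent module -/

section

variable {N : Type v} [AddCommGroup N] [Module R N]
variable {A : Type u} [CommRing A] [Algebra R A]

theorem qc_map_tmul {B : Type u} [CommRing B] [Algebra R B] (f : A →ₐ[R] B) (a : A) (n : N) :
    (qc R N).map f (a ⊗ₜ[R] n) = f a ⊗ₜ[R] n :=
  rfl

/-- Naturality along `f`, starting from the identity of `A`, gives the value at `1 ⊗ n`;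
`B`-linearity gives the rest. So a form on `𝓝|_A` is determined by its values on the elements `1 ⊗
n` over `A`. -/
theorem DualObj.qc_app_tmul (s : DualObj (qc R N) A) {B : Type u} [CommRing B] [Algebra R B]
    (f : A →ₐ[R] B) (b : B) (n : N) :
    s.app B f (b ⊗ₜ[R] n) = b * f (s.app A (AlgHom.id R A) (1 ⊗ₜ[R] n)) := by
  have h := s.naturality (AlgHom.id R A) f ((1 : A) ⊗ₜ[R] n)
  rw [AlgHom.comp_id, qc_map_tmul, map_one] at h
  rw [← h, ← smul_eq_mul, ← _root_.map_smul, TensorProduct.smul_tmul', smul_eq_mul, mul_one]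

theorem DualObj.qc_ext {s t : DualObj (qc R N) A}
    (h : ∀ n : N, s.app A (AlgHom.id R A) (1 ⊗ₜ[R] n) = t.app A (AlgHom.id R A) (1 ⊗ₜ[R] n)) :
    s = t := by
  refine DualObj.ext' fun B _ _ f m => ?_
  induction m using TensorProduct.induction_on with
  | zero => rw [map_zero, map_zero]
  | tmul b n => rw [s.qc_app_tmul, t.qc_app_tmul, h]
  | add x y hx hy => rw [map_add, map_add, hx, hy]

/-- The form on `𝓝|_A` defined by an `R`-linear map `N → A`. -/
noncomputable def DualObj.ofLinearMap (l : N →ₗ[R] A) : DualObj (qc R N) A where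
  app B _ _ f := (f.toLinearMap ∘ₗ l).liftBaseChange B
  naturality {B C} _ _ _ _ f g m := by
    induction m using TensorProduct.induction_on with
    | zero => simp only [map_zero]
    | tmul b n => simp
    | add x y hx hy => simp only [map_add, hx, hy]

theorem DualObj.ofLinearMap_app_tmul (l : N →ₗ[R] A) {B : Type u} [CommRing B] [Algebra R B]
    (f : A →ₐ[R] B) (b : B) (n : N) :
    (DualObj.ofLinearMap l).app B f (b ⊗ₜ[R] n) = b * f (l n) := by
  simp [DualObj.ofLinearMap]

variable (R N A) in
/-- `𝓝^*(A) = Hom_R(N, A)`. -/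
noncomputable def dualQcEquiv : DualObj (qc R N) A ≃ₗ[A] (N →ₗ[R] A) where
  toFun s := (s.app A (AlgHom.id R A)).restrictScalars R ∘ₗ TensorProduct.mk R A N 1
  map_add' _ _ := rfl
  map_smul' _ _ := rfl
  invFun := DualObj.ofLinearMap
  left_inv s := DualObj.qc_ext fun n => by
    rw [DualObj.ofLinearMap_app_tmul, one_mul]
    rfl
  right_inv l := by
    ext n
    exact (DualObj.ofLinearMap_app_tmul l _ 1 n).trans (one_mul _)

theorem dualQcEquiv_map (s : DualObj (qc R N) A) {B : Type u} [CommRing B] [Algebra R B]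
    (f : A →ₐ[R] B) :
    dualQcEquiv R N B ((dual (qc R N)).map f s) = f.toLinearMap ∘ₗ dualQcEquiv R N A s := by
  ext n
  exact (s.qc_app_tmul _ 1 n).trans (one_mul _)

/-- Under `dualQcEquiv` the map becomes composition with `f` on `Hom_R(N, -)`. -/
theorem dual_qc_map_injective {B : Type u} [CommRing B] [Algebra R B] {f : A →ₐ[R] B}
    (hf : Function.Injective f) : Function.Injective ((dual (qc R N)).map f) := by
  intro s t h
  apply (dualQcEquiv R N A).injective
  ext n
  apply hf
  have h' := congrArg (fun k => dualQcEquiv R N B k n) h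
  rwa [dualQcEquiv_map, dualQcEquiv_map] at h'

end

/-! ### The morphism `𝓝 → 𝓝_sch` -/

/-- Both sides evaluate a form `d` on `𝕃` at the image of `n` under `φ`. -/
theorem schMap_app_toSch {𝕄 : FunctorModule.{u, w} R} {𝕃 : FunctorModule.{u, w'} R}
    (φ : Hom 𝕄 𝕃) {A : Type u} [CommRing A] [Algebra R A] (n : 𝕄.obj A) :
    (schMap φ).app A ((toSch 𝕄).app A n) = (toSch 𝕃).app A (φ.app A n) := by
  refine DualObj.qc_ext fun d => ?_
  change evalAt 𝕄 (𝕄.map (AlgHom.id R A) n) (1 ⊗ₜ[R] (dualMap φ).app R d) =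
    evalAt 𝕃 (𝕃.map (AlgHom.id R A) (φ.app A n)) (1 ⊗ₜ[R] d)
  rw [𝕄.map_id, 𝕃.map_id, evalAt_tmul, evalAt_tmul]
  rfl

theorem toSch_app_tmul {𝕄 : FunctorModule.{u, w} R} {A : Type u} [CommRing A] [Algebra R A]
    (n : 𝕄.obj A) (d : DualObj 𝕄 R) :
    ((toSch 𝕄).app A n).app A (AlgHom.id R A) (1 ⊗ₜ[R] d) = d.app A (Algebra.ofId R A) n := by
  change evalAt 𝕄 (𝕄.map (AlgHom.id R A) n) (1 ⊗ₜ[R] d) = _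
  rw [𝕄.map_id, evalAt_tmul, one_mul]

/-- `𝓕 → 𝓕_sch` is bijective if `F` is free of finite rank. -/
theorem toSch_qc_bijective {F : Type v} [AddCommGroup F] [Module R F] {ι : Type*} [Finite ι]
    (b : Module.Basis ι R F) (A : Type u) [CommRing A] [Algebra R A] :
    Function.Bijective ((toSch (qc R F)).app A) := by
  classical
  have _ := Fintype.ofFinite ι
  -- The forms dual to `b` compute the coordinates in the basis obtained from `b` by base change.
  have coord (i : ι) (x : A ⊗[R] F) :
      (DualObj.ofLinearMap (b.coord i)).app A (Algebra.ofId R A) x =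
        (b.baseChange A).repr x i := by
    induction x using TensorProduct.induction_on with
    | zero => simp
    | tmul a n =>
      rw [DualObj.ofLinearMap_app_tmul, Module.Basis.baseChange_repr_tmul,
        Module.Basis.coord_apply, Algebra.smul_def, mul_comm]
      rfl
    | add x y hx hy => rw [map_add, map_add, hx, hy]; rfl
  constructor
  · rw [injective_iff_map_eq_zero]
    intro x hx
    apply (b.baseChange A).repr.injective
    ext i
    rw [← coord, ← toSch_app_tmul, hx, map_zero]
    rfl
  · intro s
    -- The `i`-th coordinate of the preimage has to be the value of `s` at the `i`-th dual basis
    -- form.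
    refine ⟨∑ i, s.app A (AlgHom.id R A) (1 ⊗ₜ[R] DualObj.ofLinearMap (b.coord i)) ⊗ₜ[R] b i,
      DualObj.qc_ext fun d => ?_⟩
    -- Expansion of `d` in the dual basis, so that `s` need only be compared on that basis.
    have hd : d = ∑ i, dualQcEquiv R F R d (b i) • DualObj.ofLinearMap (b.coord i) := by
      apply (dualQcEquiv R F R).injective
      refine b.ext fun j => ?_
      have hb (i : ι) : dualQcEquiv R F R (DualObj.ofLinearMap (b.coord i)) = b.coord i :=
        (dualQcEquiv R F R).apply_symm_apply _
      simp [hb]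
    rw [toSch_app_tmul, map_sum]
    conv_rhs => rw [hd, TensorProduct.tmul_sum, map_sum]
    refine Finset.sum_congr rfl fun i _ => ?_
    rw [d.qc_app_tmul, TensorProduct.tmul_smul, ← algebraMap_smul A, _root_.map_smul, smul_eq_mul,
      mul_comm]
    rfl

/-! ### Direct limits -/

namespace DirectSystem

variable {I : Type v} [Preorder I]

theorem limOf_hom (𝔽 : DirectSystem.{u, v, w} R I) {i j : I} (h : i ≤ j) {A : Type u} [CommRing A]
    [Algebra R A] (x : (𝔽.obj i).obj A) : 𝔽.limOf j A ((𝔽.hom h).app A x) = 𝔽.limOf i A x := by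
  simpa only [FunctorModule.map_id] using 𝔽.limOf_compat (AlgHom.id R A) i j h x

theorem exists_hom_eq_zero [IsDirectedOrder I] (𝔽 : DirectSystem.{u, v, w} R I) {i : I}
    {A : Type u} [CommRing A] [Algebra R A] {x : (𝔽.obj i).obj A} (hx : 𝔽.limOf i A x = 0) :
    ∃ (j : I) (h : i ≤ j), (𝔽.hom h).app A x = 0 := by
  classical
  have _ : DirectedSystem (fun i => (𝔽.obj i).obj A)
      (fun i j (h : i ≤ j) => ((𝔽.hom h).app A : (𝔽.obj i).obj A → (𝔽.obj j).obj A)) :=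
    { map_self := fun i x => by rw [𝔽.hom_refl]; rfl
      map_map := fun {k j i} hij hjk x => by rw [← 𝔽.hom_trans hij hjk]; rfl }
  exact Module.DirectLimit.of.zero_exact (R := A) (G := fun i => (𝔽.obj i).obj A)
    (f := fun _ _ h => (𝔽.hom h).app A) hx

/-- If the image of `m` dies in the limit, it already dies at some stage `j`; injectivity at that
stage shows that `m` itself dies there. -/
theorem limMap_injective [IsDirectedOrder I] [Nonempty I] (𝔽 : DirectSystem.{u, v, w} R I)
    {A B : Type u} [CommRing A] [Algebra R A] [CommRing B] [Algebra R B] (f : A →ₐ[R] B)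
    (hf : ∀ i, Function.Injective ((𝔽.obj i).map f)) : Function.Injective (𝔽.limMap f) := by
  rw [injective_iff_map_eq_zero]
  intro x hx
  obtain ⟨i, m, rfl⟩ := 𝔽.exists_limOf x
  rw [limMap_limOf] at hx
  obtain ⟨j, h, hj⟩ := 𝔽.exists_hom_eq_zero hx
  rw [(𝔽.hom h).naturality] at hj
  have h0 : (𝔽.hom h).app A m = 0 := hf j (hj.trans (map_zero _).symm)
  rw [← 𝔽.limOf_hom h, h0, map_zero]

end DirectSystem

/-! ### Flatness from injectivity on square-zero extensions -/

/-- `M` is flat if `A ↦ A ⊗_R M` preserves injective morphisms of `R`-algebras. -/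
theorem flat_of_qc_map_injective (M : Type v) [AddCommGroup M] [Module R M]
    (h : ∀ (A B : Type u) [CommRing A] [Algebra R A] [CommRing B] [Algebra R B] (f : A →ₐ[R] B),
      Function.Injective f → Function.Injective ((qc R M).map f)) : Module.Flat R M := by
  rw [Module.Flat.iff_rTensor_injective']
  intro I
  rw [injective_iff_map_eq_zero]
  intro x hx
  -- The inclusion `I → R` is not a morphism of algebras, but `R ⊕ I → R ⊕ R` is one, with `I` and
  -- `R` as square-zero ideals.
  let f : TrivSqZeroExt R I →ₐ[R] TrivSqZeroExt R R := TrivSqZeroExt.map I.subtype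
  have hf : Function.Injective f := by
    intro a b hab
    have h₁ := congrArg TrivSqZeroExt.fst hab
    have h₂ := congrArg TrivSqZeroExt.snd hab
    simp only [f, TrivSqZeroExt.fst_map, TrivSqZeroExt.snd_map] at h₁ h₂
    exact TrivSqZeroExt.ext h₁ (Subtype.ext h₂)
  have hinr : f.toLinearMap ∘ₗ TrivSqZeroExt.inrHom R I =
      TrivSqZeroExt.inrHom R R ∘ₗ I.subtype := by
    ext m <;> simp [f]
  have h0 : (TrivSqZeroExt.inrHom R I).rTensor M x = 0 := by
    apply h _ _ f hf
    rw [map_zero]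
    change f.toLinearMap.rTensor M _ = 0
    rw [← LinearMap.rTensor_comp_apply, hinr, LinearMap.rTensor_comp_apply, hx, map_zero]
  -- `I` is a direct summand of `R ⊕ I`, so nothing is lost by having tensored the larger module
  -- with `M`.
  have hsnd : TrivSqZeroExt.sndHom R I ∘ₗ TrivSqZeroExt.inrHom R I = LinearMap.id := by
    ext m
    simp
  rw [← LinearMap.id_apply (R := R) x, ← LinearMap.rTensor_id, ← hsnd,
    LinearMap.rTensor_comp_apply, h0, map_zero]

/-! ### The canonical morphism `𝓜 → lim_i 𝓜_{i,sch}` -/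

section

variable {M : Type v} [AddCommGroup M] [Module R M]

/-- A tensor involves only finitely many elements of `M`; directedness brings the two terms of a sum
into one submodule. -/
theorem exists_fgSubmodule_qcMap_eq {A : Type u} [CommRing A] [Algebra R A] (x : A ⊗[R] M) :
    ∃ (N : FGSubmodule R M) (y : A ⊗[R] N.1), (qcMap N.1.subtype).app A y = x := by
  induction x using TensorProduct.induction_on with
  | zero => exact ⟨⟨⊥, Submodule.fg_bot⟩, 0, map_zero _⟩
  | tmul a m =>
    exact ⟨⟨R ∙ m, Submodule.fg_span_singleton m⟩,
      a ⊗ₜ[R] ⟨m, Submodule.mem_span_singleton_self m⟩, rfl⟩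
  | add x y hx hy =>
    obtain ⟨N, x, rfl⟩ := hx
    obtain ⟨N', y, rfl⟩ := hy
    obtain ⟨K, h, h'⟩ := exists_ge_ge N N'
    refine ⟨K, (qcMap (Submodule.inclusion h)).app A x +
      (qcMap (Submodule.inclusion h')).app A y, ?_⟩
    rw [map_add]
    have hc (L : FGSubmodule R M) (h : L ≤ K) (z : A ⊗[R] L.1) :
        (qcMap K.1.subtype).app A ((qcMap (Submodule.inclusion h)).app A z) =
          (qcMap L.1.subtype).app A z :=
      congrArg (fun k => k.app A z) (qcMap_comp K.1.subtype (Submodule.inclusion h)).symm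
    rw [hc N h, hc N' h']

variable (R M) in
/-- The composite `𝓜_i → 𝓜_{i,sch} → lim_j 𝓜_{j,sch}`. -/
noncomputable def fgToLim (N : FGSubmodule R M) : Hom (qc R N.1) (schSystem R M).lim :=
  ((schSystem R M).toLim N).comp (toSch (qc R N.1))

theorem fgToLim_app {A : Type u} [CommRing A] [Algebra R A] (N : FGSubmodule R M)
    (x : A ⊗[R] N.1) :
    (fgToLim R M N).app A x = (schSystem R M).limOf N A ((toSch (qc R N.1)).app A x) :=
  rfl

theorem fgToLim_inclusion {A : Type u} [CommRing A] [Algebra R A] {N N' : FGSubmodule R M}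
    (h : N ≤ N') (x : A ⊗[R] N.1) :
    (fgToLim R M N').app A ((qcMap (Submodule.inclusion h)).app A x) =
      (fgToLim R M N).app A x := by
  rw [fgToLim_app, fgToLim_app, ← schMap_app_toSch]
  exact (schSystem R M).limOf_hom h _

/-- The two submodules are compared inside a common larger one. This independence makes the map out
of `A ⊗ M` below, built from the submodules `R m`, additive and balanced. -/
theorem fgToLim_tmul_eq {A : Type u} [CommRing A] [Algebra R A] (N N' : FGSubmodule R M) (a : A)
    {m : M} (hm : m ∈ N.1) (hm' : m ∈ N'.1) :
    (fgToLim R M N).app A (a ⊗ₜ[R] ⟨m, hm⟩) = (fgToLim R M N').app A (a ⊗ₜ[R] ⟨m, hm'⟩) := by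
  obtain ⟨K, h, h'⟩ := exists_ge_ge N N'
  rw [← fgToLim_inclusion h, ← fgToLim_inclusion h']
  rfl

/-- The finitely generated submodule `R m`. -/
abbrev spanFG (m : M) : FGSubmodule R M := ⟨R ∙ m, Submodule.fg_span_singleton m⟩

variable (R M) in
/-- The map `A ⊗_R M → lim_i M_{i,sch}(A)`. -/
noncomputable def qcToLimAddHom (A : Type u) [CommRing A] [Algebra R A] :
    A ⊗[R] M →+ (schSystem R M).limObj A :=
  TensorProduct.liftAddHom
    (AddMonoidHom.mk'
      (fun a => AddMonoidHom.mk'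
        (fun m => (fgToLim R M (spanFG m)).app A
          (a ⊗ₜ[R] ⟨m, Submodule.mem_span_singleton_self m⟩))
        (fun m m' => by
          -- `R m`, `R m'` and `R (m + m')` all lie in `K`, where additivity is that of a single
          -- morphism.
          obtain ⟨K, h, h'⟩ := exists_ge_ge (spanFG (R := R) m) (spanFG m')
          have hm : m ∈ K.1 := h (Submodule.mem_span_singleton_self m)
          have hm' : m' ∈ K.1 := h' (Submodule.mem_span_singleton_self m')
          rw [fgToLim_tmul_eq _ K a _ (K.1.add_mem hm hm'), fgToLim_tmul_eq _ K a _ hm,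
            fgToLim_tmul_eq _ K a _ hm', ← map_add, ← TensorProduct.tmul_add]
          rfl))
      (fun a a' => by
        ext m
        simp only [AddMonoidHom.mk'_apply, AddMonoidHom.add_apply, TensorProduct.add_tmul,
          map_add]))
    (fun r a m => by
      have hm : r • m ∈ (spanFG (R := R) m).1 :=
        Submodule.smul_mem _ _ (Submodule.mem_span_singleton_self m)
      simp only [AddMonoidHom.mk'_apply]
      rw [fgToLim_tmul_eq (spanFG (r • m)) (spanFG m) a _ hm, TensorProduct.smul_tmul]
      rfl)

theorem qcToLimAddHom_qcMap {A : Type u} [CommRing A] [Algebra R A] (N : FGSubmodule R M)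
    (x : A ⊗[R] N.1) :
    qcToLimAddHom R M A ((qcMap N.1.subtype).app A x) = (fgToLim R M N).app A x := by
  induction x using TensorProduct.induction_on with
  | zero => simp only [map_zero]
  | tmul a n => exact fgToLim_tmul_eq _ _ a _ n.2
  | add x y hx hy => simp only [map_add, hx, hy]

variable (R M) in
/-- The canonical morphism `𝓜 → lim_i 𝓜_{i,sch}`. -/
noncomputable def qcToLim : Hom (qc R M) (schSystem R M).lim where
  app A _ _ :=
    { qcToLimAddHom R M A with
      map_smul' := fun a x => by
        -- Every element comes from some `𝓜_i`, on which the map is the morphism `fgToLim`.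
        obtain ⟨N, y, rfl⟩ := exists_fgSubmodule_qcMap_eq x
        change qcToLimAddHom R M A (a • (qcMap N.1.subtype).app A y) =
          a • qcToLimAddHom R M A ((qcMap N.1.subtype).app A y)
        rw [← _root_.map_smul, qcToLimAddHom_qcMap, qcToLimAddHom_qcMap, _root_.map_smul] }
  naturality {A B} _ _ _ _ f x := by
    obtain ⟨N, y, rfl⟩ := exists_fgSubmodule_qcMap_eq x
    rw [← (qcMap N.1.subtype).naturality]
    exact (qcToLimAddHom_qcMap N _).trans (((fgToLim R M N).naturality f y).trans
      (congrArg _ (qcToLimAddHom_qcMap N y).symm))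

theorem qcToLim_qcMap {A : Type u} [CommRing A] [Algebra R A] (N : FGSubmodule R M)
    (x : A ⊗[R] N.1) :
    (qcToLim R M).app A ((qcMap N.1.subtype).app A x) =
      (schSystem R M).limOf N A ((toSch (qc R N.1)).app A x) :=
  qcToLimAddHom_qcMap N x

theorem exists_inclusion_eq_zero {A : Type u} [CommRing A] [Algebra R A] {N : FGSubmodule R M}
    {x : A ⊗[R] N.1} (hx : (schSystem R M).limOf N A ((toSch (qc R N.1)).app A x) = 0) :
    ∃ (K : FGSubmodule R M) (h : N ≤ K),
      (toSch (qc R K.1)).app A ((qcMap (Submodule.inclusion h)).app A x) = 0 := by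
  obtain ⟨K, h, hK⟩ := (schSystem R M).exists_hom_eq_zero hx
  refine ⟨K, h, ?_⟩
  rw [← schMap_app_toSch]
  exact hK

/-- An element of the kernel dies in `𝓚_sch` for some finitely generated `K`. Factoring `K → M`
through `R^k`, its image in `A ⊗ R^k` vanishes, because `toSch` is injective there; hence so does
its image in `A ⊗ M`. -/
theorem qcToLim_injective [IsNoetherianRing R] [Module.Flat R M] (A : Type u) [CommRing A]
    [Algebra R A] : Function.Injective ((qcToLim R M).app A) := by
  rw [injective_iff_map_eq_zero]
  intro x hx
  obtain ⟨N, y, rfl⟩ := exists_fgSubmodule_qcMap_eq x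
  rw [qcToLim_qcMap] at hx
  obtain ⟨K, h, hK⟩ := exists_inclusion_eq_zero hx
  have _ : Module.Finite R K.1 := Module.Finite.iff_fg.mpr K.2
  have _ : Module.FinitePresentation R K.1 := Module.finitePresentation_of_finite R K.1
  obtain ⟨k, p, q, hpq⟩ := Module.Flat.exists_factorization_of_finitePresentation K.1.subtype
  have hsub : N.1.subtype = q ∘ₗ p ∘ₗ Submodule.inclusion h := by
    rw [← LinearMap.comp_assoc, ← hpq]
    rfl
  have hp : (qcMap p).app A ((qcMap (Submodule.inclusion h)).app A y) = 0 := by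
    apply (toSch_qc_bijective Finsupp.basisSingleOne A).1
    rw [map_zero, ← schMap_app_toSch]
    exact (congrArg ((schMap (qcMap p)).app A) hK).trans (map_zero _)
  rw [hsub, qcMap_comp, qcMap_comp]
  exact (congrArg ((qcMap q).app A) hp).trans (map_zero _)

/-- Factor `N → M` as `q ∘ p` through `R^k`. The image of `s` in `(R^k)_sch` comes from some `z` in
`A ⊗ R^k`, and the image of `z` in `A ⊗ M` is the required preimage. -/
theorem qcToLim_surjective [IsNoetherianRing R] [Module.Flat R M] (A : Type u) [CommRing A]
    [Algebra R A] : Function.Surjective ((qcToLim R M).app A) := by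
  intro x
  obtain ⟨N, s, rfl⟩ := (schSystem R M).exists_limOf x
  have _ : Module.Finite R N.1 := Module.Finite.iff_fg.mpr N.2
  have _ : Module.FinitePresentation R N.1 := Module.finitePresentation_of_finite R N.1
  obtain ⟨k, p, q, hpq⟩ := Module.Flat.exists_factorization_of_finitePresentation N.1.subtype
  -- Adding the image of `q` makes the inclusion `N → K`, and not only `N → M`, factor through
  -- `R^k`; the transition morphism then factors through `(R^k)_sch`.
  let K : FGSubmodule R M :=
    ⟨N.1 ⊔ LinearMap.range q, N.2.sup (Module.Finite.iff_fg.mp inferInstance)⟩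
  have h : N ≤ K := (le_sup_left : N.1 ≤ N.1 ⊔ LinearMap.range q)
  have hq : ∀ z, q z ∈ K.1 := fun z => Submodule.mem_sup_right (LinearMap.mem_range_self q z)
  have hincl : Submodule.inclusion h = q.codRestrict K.1 hq ∘ₗ p := by
    ext n
    exact LinearMap.congr_fun hpq n
  obtain ⟨z, hz⟩ := (toSch_qc_bijective Finsupp.basisSingleOne A).2 ((schMap (qcMap p)).app A s)
  refine ⟨(qcMap K.1.subtype).app A ((qcMap (q.codRestrict K.1 hq)).app A z), ?_⟩
  rw [qcToLim_qcMap, ← schMap_app_toSch, hz, ← (schSystem R M).limOf_hom h s]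
  congr 1
  change _ = (schMap (qcMap (Submodule.inclusion h))).app A s
  rw [hincl, qcMap_comp, schMap_comp]
  rfl

end

/-- Naturality of `θ` reduces injectivity of `A ⊗ M → B ⊗ M` to that of the map between the limits.
-/
theorem flat_of_isIso_lim {M : Type v} [AddCommGroup M] [Module R M]
    {θ : Hom (qc R M) (schSystem R M).lim} (hθ : θ.IsIso) : Module.Flat R M := by
  refine flat_of_qc_map_injective M fun A B _ _ _ _ f hf x y hxy => ?_
  apply hθ.injective A
  apply (schSystem R M).limMap_injective f fun N => dual_qc_map_injective hf
  have h := congrArg (θ.app B) hxy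
  rwa [θ.naturality, θ.naturality] at h

/-! ### `𝓝_sch` as the functor of points of `Spec S^·(N^*)` -/

/-- The isomorphism `𝓝_sch ≃ (Spec S^·(N^*))^·`. -/
noncomputable def schToSpecSym (N : Type u) [AddCommGroup N] [Module R N] :
    Hom (sch (qc R N)) (specSym R (Module.Dual R N)) where
  app A _ _ :=
    -- `dualQcEquiv` serves twice: for `𝓝_sch(A) = Hom_R(𝓝^*(R), A)` and for `𝓝^*(R) = Hom_R(N, R)`.
    { toFun := fun s => SpecSymPoint.equiv.symm
        (dualQcEquiv R (DualObj (qc R N) R) A s ∘ₗ (dualQcEquiv R N R).symm.toLinearMap)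
      map_add' := fun s t => SpecSymPoint.equiv.injective (by
        rw [SpecSymPoint.equiv_add]
        simp only [Equiv.apply_symm_apply, map_add, LinearMap.add_comp])
      map_smul' := fun a s => SpecSymPoint.equiv.injective (by
        rw [RingHom.id_apply, SpecSymPoint.equiv_smul]
        simp only [Equiv.apply_symm_apply, _root_.map_smul, LinearMap.smul_comp]) }
  naturality {A B} _ _ _ _ f s := SpecSymPoint.equiv.injective (by
    refine Eq.trans ?_ (SpecSymPoint.equiv_map f _).symm
    change SpecSymPoint.equiv (SpecSymPoint.equiv.symm _) =
      f.toLinearMap ∘ₗ SpecSymPoint.equiv (SpecSymPoint.equiv.symm _)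
    rw [Equiv.apply_symm_apply, Equiv.apply_symm_apply, dualQcEquiv_map, LinearMap.comp_assoc])

theorem schToSpecSym_isIso (N : Type u) [AddCommGroup N] [Module R N] :
    (schToSpecSym (R := R) N).IsIso := by
  refine Hom.isIso_of_bijective _ fun A _ _ => ?_
  change Function.Bijective (SpecSymPoint.equiv.symm ∘
    (fun l : DualObj (qc R N) R →ₗ[R] A => l ∘ₗ (dualQcEquiv R N R).symm.toLinearMap) ∘
      dualQcEquiv R (DualObj (qc R N) R) A)
  refine SpecSymPoint.equiv.symm.bijective.comp
    (Function.Bijective.comp ?_ (dualQcEquiv R (DualObj (qc R N) R) A).bijective)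
  refine Function.bijective_iff_has_inverse.mpr
    ⟨fun l => l ∘ₗ (dualQcEquiv R N R).toLinearMap, fun l => ?_, fun l => ?_⟩
  · ext d
    simp
  · ext d
    simp

end

end FunctorModule

theorem mainTheorem5 (R : Type u) [CommRing R] [IsNoetherianRing R]
    (M : Type u) [AddCommGroup M] [Module R M] :
    (Module.Flat R M ↔
      ∃ θ : FunctorModule.Hom (FunctorModule.qc R M) (FunctorModule.schSystem R M).lim,
        (∀ N : FunctorModule.FGSubmodule R M,
          θ.comp (FunctorModule.qcMap N.1.subtype) =
            ((FunctorModule.schSystem R M).toLim N).comp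
              (FunctorModule.toSch (FunctorModule.qc R N.1))) ∧
        θ.IsIso) ∧
    (Module.Flat R M ↔
      ∃ θ : FunctorModule.Hom (FunctorModule.qc R M) (FunctorModule.schSystem R M).lim,
        θ.IsIso) ∧
    (∀ N : FunctorModule.FGSubmodule R M,
      ∃ θ : FunctorModule.Hom (FunctorModule.sch (FunctorModule.qc R N.1))
          (FunctorModule.specSym R (Module.Dual R N.1)),
        θ.IsIso) := by
  have isIso (_ : Module.Flat R M) : (FunctorModule.qcToLim R M).IsIso :=
    FunctorModule.Hom.isIso_of_bijective _ fun A _ _ =>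
      ⟨FunctorModule.qcToLim_injective A, FunctorModule.qcToLim_surjective A⟩
  refine ⟨⟨fun h => ⟨FunctorModule.qcToLim R M, fun N => ?_, isIso h⟩, ?_⟩,
    ⟨fun h => ⟨_, isIso h⟩, ?_⟩, fun N => ⟨_, FunctorModule.schToSpecSym_isIso N.1⟩⟩
  · refine FunctorModule.Hom.ext ?_
    funext A _ _
    exact LinearMap.ext (FunctorModule.qcToLim_qcMap N)
  · rintro ⟨θ, -, hθ⟩
    exact FunctorModule.flat_of_isIso_lim hθ
  · rintro ⟨θ, hθ⟩
    exact FunctorModule.flat_of_isIso_lim hθ
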